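/- Let $K$ be a sextic CM field with complex conjugation $x \mapsto \overline{x}$, maximal real subfield $K_0$ and Galois closure $L$. Write $\mathbb{Z}_F$ for the ring of integers of a number field $F$. Suppose that $\mathrm{Gal}(L|\mathbb{Q})$ is isomorphic to $C_2^3 \rtimes C_3$ or $C_2^3 \rtimes S_3$, where $C_3$ (generated by a 3-cycle) and $S_3$ act on $C_2^3$ by permuting the coordinates. Let $\Phi$ be a CM type of $K$ with values in $L$, that is, a subset $\Phi \subset \mathrm{Hom}(K, L)$ such that $\mathrm{Hom}(K, L)$ is the disjoint union of $\Phi$ and $\{\varphi \circ \overline{\,\cdot\,} : \varphi \in \Phi\}$. Let $\Phi_L = \{ \sigma \in \mathrm{Gal}(L|\mathbb{Q}) : \sigma|_K \in \Phi \}$. The reflex field $K^r \subset L$ is the fixed field of $\{ \sigma \in \mathrm{Gal}(L|\mathbb{Q}) : \sigma \Phi_L = \Phi_L \}$, and the reflex type is $\Phi^r = \{ \sigma^{-1}|_{K^r} : \sigma \in \Phi_L \} \subset \mathrm{Hom}(K^r, L)$. For nonzero fractional ideals $\mathfrak{a}$ of $K$ and $\mathfrak{c}$ of $K^r$ put $$N_\Phi(\mathfrak{a})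 = K^r \cap \prod_{\varphi \in \Phi} \varphi(\mathfrak{a}) \mathbb{Z}_L, \qquad N_{\Phi^r}(\mathfrak{c}) = K \cap \prod_{\psi \in \Phi^r} \psi(\mathfrak{c}) \mathbb{Z}_L ;$$ the latter induces the reflex type norm $N_{\Phi^r} : \mathrm{Cl}(K^r) \to \mathrm{Cl}(K)$. Then: 1. For every nonzero fractional ideal $\mathfrak{a}$ of $K$, with absolute norm $N_{K|\mathbb{Q}}(\mathfrak{a})$, there is an equality of fractional ideals of $L$ $$\prod_{\psi \in \Phi^r} \psi\bigl(N_\Phi(\mathfrak{a})\bigr) \mathbb{Z}_L = N_{K|\mathbb{Q}}(\mathfrak{a})^2 \, (\mathfrak{a}\,\overline{\mathfrak{a}}^{-1})^2 \, \mathbb{Z}_L .$$ 2. If $\mathfrak{b}$ is a nonzero fractional ideal of $K$ with $\mathfrak{b}\,\overline{\mathfrak{b}} = \beta \mathbb{Z}_K$ for some $\beta \in K_0^*$, then the class $[\mathfrak{b}^4]$ lies in the image of the reflex type norm $N_{\Phi^r} : \mathrm{Cl}(K^r) \to \mathrm{Cl}(K)$. -/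

import Mathlib

open scoped NumberField nonZeroDivisors Pointwise

namespace SexticCM

open NumberField

noncomputable section

/-- The group `C₂³`, written multiplicatively. -/
abbrev C2Cubed : Type := Fin 3 → Multiplicative (ZMod 2)

/-- The subgroup `C₃ = ⟨(1 2 3)⟩` of `S₃`. -/
abbrev C3 : Subgroup (Equiv.Perm (Fin 3)) := Subgroup.zpowers (finRotate 3)

/-- `C₂³ ⋊ S₃`, with `S₃` permuting the coordinates. -/
abbrev C2CubedS3 : Type :=
  C2Cubed ⋊[(mulAutArrow : Equiv.Perm (Fin 3) →* MulAut C2Cubed)] Equiv.Perm (Fin 3)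

/-- `C₂³ ⋊ C₃`, with `C₃` permuting the coordinates cyclically. -/
abbrev C2CubedC3 : Type :=
  C2Cubed ⋊[(mulAutArrow : Equiv.Perm (Fin 3) →* MulAut C2Cubed).comp C3.subtype] C3

/-! ### CM types and their reflexes -/

section CMTypes

variable {K L : Type*} [Field K] [NumberField K] [Field L] [NumberField L]

/-- Complex conjugation of the CM field `K`, as a `ℚ`-algebra homomorphism. -/
def conj (K : Type*) [Field K] [NumberField K] [IsCMField K] : K →ₐ[ℚ] K :=
  ((IsCMField.complexConj K).restrictScalars ℚ : K ≃ₐ[ℚ] K)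

/-- A CM type of `K` with values in `L`: a set `Φ` of embeddings `K → L` such that
`Hom(K, L)` is the disjoint union of `Φ` and `Φρ`, with `ρ` the complex conjugation of `K`. -/
def IsCMType [IsCMField K] (Φ : Set (K →ₐ[ℚ] L)) : Prop :=
  IsCompl Φ ((fun φ ↦ φ.comp (conj K)) '' Φ)

variable [Algebra K L]

/-- The set `Φ_L` of all `σ ∈ Gal(L/ℚ)` whose restriction to `K` lies in `Φ`. -/
def liftType (Φ : Set (K →ₐ[ℚ] L)) : Set (L ≃ₐ[ℚ] L) :=
  {σ | (σ : L →ₐ[ℚ] L).comp (IsScalarTower.toAlgHom ℚ K L) ∈ Φ}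

/-- The reflex field `K^r ⊆ L`: the fixed field of `{σ ∈ Gal(L/ℚ) | σ Φ_L = Φ_L}`. -/
def reflexField (Φ : Set (K →ₐ[ℚ] L)) : IntermediateField ℚ L :=
  IntermediateField.fixedField (MulAction.stabilizer (L ≃ₐ[ℚ] L) (liftType Φ))

/-- The reflex type `Φ^r`: the set of restrictions to `K^r` of the elements of `Φ_L⁻¹`. -/
def reflexType (Φ : Set (K →ₐ[ℚ] L)) : Set (reflexField Φ →ₐ[ℚ] L) :=
  (fun σ : L ≃ₐ[ℚ] L ↦ (σ : L →ₐ[ℚ] L).comp (reflexField Φ).val) '' (liftType Φ)⁻¹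

end CMTypes

/-! ### Type norms -/

section Ideals

variable {E F : Type*} [Field E] [NumberField E] [Field F] [NumberField F]

/-- For a field embedding `f : E → F`, the map `I ↦ f(I) ℤ_F` on fractional ideals. -/
def mapIdeal (f : E →+* F) : FractionalIdeal (𝓞 E)⁰ E →+* FractionalIdeal (𝓞 F)⁰ F :=
  FractionalIdeal.extendedHom' (f := RingOfIntegers.mapRingHom f) F
    (nonZeroDivisors_le_comap_nonZeroDivisors_of_injective _
      (fun _ _ h ↦ RingOfIntegers.ext (f.injective (congrArg (fun z : 𝓞 F ↦ (z : F)) h))))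

theorem isLocalization_map_eq (f : E →+* F) (h) (x : E) :
    IsLocalization.map (M := (𝓞 E)⁰) (T := (𝓞 F)⁰) F (RingOfIntegers.mapRingHom f) h x = f x := by
  have := IsLocalization.ringHom_ext (R := 𝓞 E) (M := (𝓞 E)⁰) (S := E)
    (j := IsLocalization.map (M := (𝓞 E)⁰) (T := (𝓞 F)⁰) F (RingOfIntegers.mapRingHom f) h)
    (k := f) (by ext y; simp)
  exact congrArg (fun g : E →+* F ↦ g x) this

theorem coe_mapIdeal (f : E →+* F) (I : FractionalIdeal (𝓞 E)⁰ E) :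
    (mapIdeal f I : Submodule (𝓞 F) F) = Submodule.span (𝓞 F) (f '' (I : Set E)) := by
  rw [mapIdeal, FractionalIdeal.extendedHom'_apply, FractionalIdeal.coe_extended_eq_span]
  congr 2
  ext x
  exact isLocalization_map_eq f _ x

theorem mapIdeal_spanSingleton (f : E →+* F) (x : E) :
    mapIdeal f (FractionalIdeal.spanSingleton (𝓞 E)⁰ x) =
      FractionalIdeal.spanSingleton (𝓞 F)⁰ (f x) := by
  rw [mapIdeal, FractionalIdeal.extendedHom'_apply, FractionalIdeal.extended_spanSingleton,
    isLocalization_map_eq]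

theorem exists_int_mul (F : Type*) [Field F] [NumberField F] {L : Type*} [Field L] [NumberField L]
    [Algebra F L] {D : 𝓞 L} (hD : D ≠ 0) :
    ∃ (d : 𝓞 F) (e : 𝓞 L), d ≠ 0 ∧ algebraMap F L d = e * D := by
  have hne := Ideal.comap_ne_bot_of_integral_mem (R := 𝓞 F) (I := Ideal.span {D}) hD
    (Ideal.mem_span_singleton_self D) (Algebra.IsIntegral.isIntegral D)
  obtain ⟨d, hd, hd0⟩ := Submodule.exists_mem_ne_zero_of_ne_bot hne
  obtain ⟨e, he⟩ := Ideal.mem_span_singleton'.1 (Ideal.mem_comap.1 hd)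
  refine ⟨d, e, hd0, ?_⟩
  have h := congrArg (fun z : 𝓞 L ↦ (z : L)) he
  exact h.symm.trans (map_mul (algebraMap (𝓞 L) L) e D)

/-- For an extension `L/F`, the contraction `J ↦ F ∩ J` of fractional ideals. -/
def contract (F : Type*) [Field F] [NumberField F] {L : Type*} [Field L] [NumberField L]
    [Algebra F L] (J : FractionalIdeal (𝓞 L)⁰ L) : FractionalIdeal (𝓞 F)⁰ F where
  val :=
    { carrier := {x | algebraMap F L x ∈ J}
      add_mem' := fun {x y} hx hy ↦ by
        simpa using Submodule.add_mem (J : Submodule (𝓞 L) L) hx hy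
      zero_mem' := by
        rw [Set.mem_ofPred_eq, map_zero]
        exact Submodule.zero_mem (J : Submodule (𝓞 L) L)
      smul_mem' := fun c x hx ↦ by
        have := Submodule.smul_mem (J : Submodule (𝓞 L) L) (algebraMap (𝓞 F) (𝓞 L) c) hx
        rw [Algebra.smul_def] at this
        rw [Set.mem_ofPred_eq, Algebra.smul_def, map_mul]
        exact this }
  property := by
    obtain ⟨D, hD, hJ⟩ := J.isFractional
    obtain ⟨d, e, hd, hde⟩ := exists_int_mul F (nonZeroDivisors.ne_zero hD)
    refine ⟨d, mem_nonZeroDivisors_of_ne_zero hd, fun x hx ↦ ?_⟩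
    obtain ⟨y, hy⟩ := hJ _ hx
    have hint : IsIntegral ℤ (algebraMap F L (d * x)) := by
      have : algebraMap F L (d * x) = ((e * y : 𝓞 L) : L) := by
        rw [map_mul, hde, mul_assoc]
        refine Eq.trans ?_ (map_mul (algebraMap (𝓞 L) L) e y).symm
        rw [hy, Algebra.smul_def]
      rw [this]
      exact RingOfIntegers.isIntegral_coe _
    have hint' : IsIntegral ℤ ((d : F) * x) :=
      (isIntegral_algebraMap_iff (algebraMap F L).injective).1 hint
    exact ⟨⟨_, hint'⟩, by rw [Algebra.smul_def]; rfl⟩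

end Ideals

section TypeNorm

variable {E F L : Type*} [Field E] [NumberField E] [Field F] [NumberField F]
  [Field L] [NumberField L] [Algebra F L]

theorem mem_contract {J : FractionalIdeal (𝓞 L)⁰ L} {x : F} :
    x ∈ contract F J ↔ algebraMap F L x ∈ J := Iff.rfl

theorem contract_ne_zero {J : FractionalIdeal (𝓞 L)⁰ L} (hJ : J ≠ 0) : contract F J ≠ 0 := by
  obtain ⟨y, hy, hy0⟩ : ∃ y ∈ J, y ≠ 0 := by
    simpa [FractionalIdeal.eq_zero_iff] using hJ
  obtain ⟨a, b, hb, rfl⟩ := IsFractionRing.div_surjective (A := 𝓞 L) y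
  have ha : a ≠ 0 := by rintro rfl; simp at hy0
  have hb0 : (b : L) ≠ 0 := by simpa using nonZeroDivisors.ne_zero hb
  obtain ⟨d, e, hd, hde⟩ := exists_int_mul F ha
  intro h
  have hmem : (d : F) ∈ contract F J := by
    rw [mem_contract, hde]
    have := Submodule.smul_mem (J : Submodule (𝓞 L) L) (e * b) hy
    rwa [Algebra.smul_def, map_mul, mul_assoc, mul_div_cancel₀ _ hb0] at this
  rw [h, FractionalIdeal.mem_zero_iff] at hmem
  exact hd (by simpa using hmem)

/-- The fractional ideal `∏_{ψ ∈ Ψ} ψ(𝔞) ℤ_L` of `L`, for a set `Ψ` of embeddings `E → L`. -/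
def typeNormL (Ψ : Set (E →ₐ[ℚ] L)) :
    FractionalIdeal (𝓞 E)⁰ E →* FractionalIdeal (𝓞 L)⁰ L :=
  ∏ ψ ∈ (Set.toFinite Ψ).toFinset, (mapIdeal (ψ : E →+* L) : _ →* _)

/-- The type norm `N_Ψ(𝔞) = F ∩ ∏_{ψ ∈ Ψ} ψ(𝔞) ℤ_L`, with values in fractional ideals of `F`. -/
def typeNorm (F : Type*) [Field F] [NumberField F] [Algebra F L] (Ψ : Set (E →ₐ[ℚ] L))
    (a : FractionalIdeal (𝓞 E)⁰ E) : FractionalIdeal (𝓞 F)⁰ F :=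
  contract F (typeNormL Ψ a)

theorem typeNorm_ne_zero (Ψ : Set (E →ₐ[ℚ] L)) (a : (FractionalIdeal (𝓞 E)⁰ E)ˣ) :
    typeNorm F Ψ a ≠ 0 :=
  contract_ne_zero (Units.map (typeNormL Ψ) a).ne_zero

/-- The type norm of an invertible fractional ideal, as an invertible fractional ideal. -/
def typeNormUnits (F : Type*) [Field F] [NumberField F] [Algebra F L] (Ψ : Set (E →ₐ[ℚ] L))
    (a : (FractionalIdeal (𝓞 E)⁰ E)ˣ) : (FractionalIdeal (𝓞 F)⁰ F)ˣ :=
  Units.mk0 (typeNorm F Ψ a) (typeNorm_ne_zero Ψ a)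

theorem typeNormL_spanSingleton (Ψ : Set (E →ₐ[ℚ] L)) (x : E) :
    typeNormL Ψ (FractionalIdeal.spanSingleton (𝓞 E)⁰ x) =
      FractionalIdeal.spanSingleton (𝓞 L)⁰ (∏ ψ ∈ (Set.toFinite Ψ).toFinset, ψ x) := by
  rw [typeNormL, MonoidHom.finsetProd_apply]
  generalize (Set.toFinite Ψ).toFinset = s
  classical
  induction s using Finset.induction_on with
  | empty => simp
  | insert i s hi ih =>
    rw [Finset.prod_insert hi, Finset.prod_insert hi, ih,
      ← FractionalIdeal.spanSingleton_mul_spanSingleton]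
    congr 1
    exact mapIdeal_spanSingleton _ _

theorem contract_spanSingleton_mul (y : F) (J : FractionalIdeal (𝓞 L)⁰ L) (hy : y ≠ 0) :
    contract F (FractionalIdeal.spanSingleton (𝓞 L)⁰ (algebraMap F L y) * J) =
      FractionalIdeal.spanSingleton (𝓞 F)⁰ y * contract F J := by
  have hy' : algebraMap F L y ≠ 0 := by simpa using hy
  ext x
  rw [mem_contract, FractionalIdeal.mem_singleton_mul, FractionalIdeal.mem_singleton_mul]
  constructor
  · rintro ⟨z, hz, hxz⟩
    refine ⟨x / y, ?_, by field_simp⟩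
    rw [mem_contract, map_div₀, hxz, mul_div_cancel_left₀ _ hy']
    exact hz
  · rintro ⟨z, hz, rfl⟩
    exact ⟨_, mem_contract.1 hz, by simp⟩

end TypeNorm

/-! ### The reflex type norm on class groups -/

section ReflexTypeNorm

variable {K L : Type*} [Field K] [NumberField K] [Field L] [NumberField L] [Algebra K L]

theorem exists_algebraMap_eq_prod_reflexType [IsGalois ℚ L] (Φ : Set (K →ₐ[ℚ] L))
    (x : reflexField Φ) :
    ∃ y : K, algebraMap K L y = ∏ ψ ∈ (Set.toFinite (reflexType Φ)).toFinset, ψ x := by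
  have : IsGalois K L := IsGalois.tower_top_of_isGalois ℚ K L
  rw [← Set.mem_range, IsGalois.mem_range_algebraMap_iff_fixed]
  intro h
  have key : ∀ g : L ≃ₐ[K] L, ∀ ψ ∈ reflexType Φ,
      ((g.restrictScalars ℚ : L ≃ₐ[ℚ] L) : L →ₐ[ℚ] L).comp ψ ∈ reflexType Φ := by
    rintro g _ ⟨σ, hσ, rfl⟩
    refine ⟨g.restrictScalars ℚ * σ, ?_, rfl⟩
    rw [Set.mem_inv, mul_inv_rev]
    have : ((σ⁻¹ * (g.restrictScalars ℚ)⁻¹ : L ≃ₐ[ℚ] L) : L →ₐ[ℚ] L).comp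
        (IsScalarTower.toAlgHom ℚ K L) =
        ((σ⁻¹ : L ≃ₐ[ℚ] L) : L →ₐ[ℚ] L).comp (IsScalarTower.toAlgHom ℚ K L) := by
      ext z
      exact congrArg (σ⁻¹ : L ≃ₐ[ℚ] L) (g⁻¹.commutes z)
    change _ ∈ Φ
    rw [this]
    exact hσ
  rw [map_prod]
  refine Finset.prod_bij' (fun ψ _ ↦ ((h.restrictScalars ℚ : L ≃ₐ[ℚ] L) : L →ₐ[ℚ] L).comp ψ)
    (fun ψ _ ↦ (((h⁻¹ : L ≃ₐ[K] L).restrictScalars ℚ : L ≃ₐ[ℚ] L) : L →ₐ[ℚ] L).comp ψ)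
    ?_ ?_ ?_ ?_ ?_
  · intro ψ hψ
    simpa using key h ψ (by simpa using hψ)
  · intro ψ hψ
    simpa using key h⁻¹ ψ (by simpa using hψ)
  · intro ψ _
    ext z
    exact h.symm_apply_apply (ψ z)
  · intro ψ _
    ext z
    exact h.apply_symm_apply (ψ z)
  · intro ψ _
    rfl

theorem mk_typeNormUnits_reflexType_eq [IsGalois ℚ L] (Φ : Set (K →ₐ[ℚ] L))
    (a b : (FractionalIdeal (𝓞 (reflexField Φ))⁰ (reflexField Φ))ˣ)
    (hab : a⁻¹ * b ∈ (toPrincipalIdeal (𝓞 (reflexField Φ)) (reflexField Φ)).range) :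
    ClassGroup.mk K (typeNormUnits K (reflexType Φ) a) =
      ClassGroup.mk K (typeNormUnits K (reflexType Φ) b) := by
  obtain ⟨x, hx⟩ := hab
  obtain ⟨y, hy⟩ := exists_algebraMap_eq_prod_reflexType Φ x
  have hy0 : y ≠ 0 := by
    rintro rfl
    rw [map_zero, eq_comm, Finset.prod_eq_zero_iff] at hy
    obtain ⟨ψ, -, hψ⟩ := hy
    exact x.ne_zero ((map_eq_zero ψ).1 hψ)
  have hb : typeNormUnits K (reflexType Φ) b =
      toPrincipalIdeal (𝓞 K) K (Units.mk0 y hy0) * typeNormUnits K (reflexType Φ) a := by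
    have hb' : b = toPrincipalIdeal _ _ x * a := by rw [hx]; simp [mul_comm]
    ext1
    rw [hb', Units.val_mul, coe_toPrincipalIdeal]
    simp only [typeNormUnits, Units.val_mk0, typeNorm, Units.val_mul, map_mul,
      coe_toPrincipalIdeal, typeNormL_spanSingleton]
    rw [← hy, contract_spanSingleton_mul _ _ hy0]
  rw [hb, map_mul]
  have h1 : ClassGroup.mk K (toPrincipalIdeal (𝓞 K) K (Units.mk0 y hy0)) = 1 := by
    rw [ClassGroup.mk_eq_one_iff, coe_toPrincipalIdeal]
    exact ⟨y, by rw [FractionalIdeal.coe_spanSingleton]; rfl⟩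
  rw [h1, one_mul]

/-- The reflex type norm `N_{Φ^r} : Cl(K^r) → Cl(K)`, `[𝔞] ↦ [K ∩ ∏_{ψ ∈ Φ^r} ψ(𝔞) ℤ_L]`. -/
def reflexTypeNorm [IsGalois ℚ L] (Φ : Set (K →ₐ[ℚ] L))
    (c : ClassGroup (𝓞 (reflexField Φ))) : ClassGroup (𝓞 K) :=
  Quotient.lift (fun a ↦ ClassGroup.mk K (typeNormUnits K (reflexType Φ) a))
    (fun a b hab ↦ mk_typeNormUnits_reflexType_eq Φ a b (QuotientGroup.leftRel_apply.1 hab))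
    (ClassGroup.equiv (reflexField Φ) c)

theorem reflexTypeNorm_mk [IsGalois ℚ L] (Φ : Set (K →ₐ[ℚ] L))
    (a : (FractionalIdeal (𝓞 (reflexField Φ))⁰ (reflexField Φ))ˣ) :
    reflexTypeNorm Φ (ClassGroup.mk _ a) =
      ClassGroup.mk K (typeNormUnits K (reflexType Φ) a) := by
  rw [reflexTypeNorm, ClassGroup.equiv_mk]
  have : Units.mapEquiv
      (FractionalIdeal.canonicalEquiv (𝓞 (reflexField Φ))⁰ (reflexField Φ) (reflexField Φ)) a
        = a := by
    ext1
    simp [FractionalIdeal.canonicalEquiv_self]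
  rw [this]
  rfl

end ReflexTypeNorm

end

end SexticCM

open SexticCM NumberField

open scoped commutatorElement

namespace SexticCM

/-! ### The groups `C₂³ ⋊ C₃` and `C₂³ ⋊ S₃` -/

/-! The six embeddings `K → L` form three conjugate pairs, and a CM type is a transversal of these
pairs. `Gal(L/ℚ)` acts faithfully on the embeddings and commutes with conjugation, so it lies in a
group of order 48, the centralizer of a fixed-point-free involution in `S₆`. For the two given
groups it contains the swap of each single pair (`swap_mem_of_card`), hence it is transitive on the
eight CM types.

By Galois theory `σ|_{K^r}` depends exactly on the translate `σΦ`, and `σ⁻¹ ∈ Φ_L` says that `σΦ`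
contains the inclusion `ι`. So the reflex type corresponds to the four CM types containing `ι`
(`prod_reflexType`), and `σ(N_Φ(𝔞))ℤ_L = ∏_{χ ∈ σΦ} χ(𝔞)ℤ_L`. This uses that contracting the type
norm to `K^r` loses nothing (`mapIdeal_typeNorm`). Over the four types `ι` occurs four times, its
conjugate never and each other embedding twice. The product is therefore the square of the full
norm, times `𝔞²`, divided by the square of the conjugate of `𝔞` (`prod_transversals`).

If `𝔟` times its conjugate is `(β)`, the formula for `𝔟` becomes `N(𝔟)² β⁻² 𝔟⁴`, which has the class
of `𝔟⁴`. -/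

theorem natCard_C2CubedC3 : Nat.card C2CubedC3 = 24 := by
  have h : orderOf (finRotate 3) = 3 := orderOf_eq_prime (by decide) (by decide)
  rw [SemidirectProduct.card, Nat.card_zpowers, h]
  simp

theorem natCard_C2CubedS3 : Nat.card C2CubedS3 = 48 := by
  rw [SemidirectProduct.card]
  simp [Nat.card_eq_fintype_card, Fintype.card_perm, Nat.factorial]

/-- The quotient `C₃` is abelian, so commutators lie in the elementary abelian kernel. This
separates the group from the index-two subgroups of the centralizer that miss a swap. -/
theorem commutatorElement_sq_C2CubedC3 (g h : C2CubedC3) : ⁅g, h⁆ ^ 2 = 1 := by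
  have hr : (⁅g, h⁆).right = 1 := by
    change SemidirectProduct.rightHom ⁅g, h⁆ = 1
    rw [map_commutatorElement, commutatorElement_eq_one_iff_mul_comm, mul_comm']
  have key : ∀ x : C2CubedC3, x.right = 1 → x ^ 2 = 1 := by
    intro x hx
    ext1
    · rw [sq, SemidirectProduct.mul_left, hx, map_one, MulAut.one_apply, SemidirectProduct.one_left]
      ext i
      have h2 : ∀ y : Multiplicative (ZMod 2), y * y = 1 := by decide
      exact congrArg Multiplicative.toAdd (h2 (x.left i))
    · rw [sq, SemidirectProduct.mul_right, hx, SemidirectProduct.one_right, mul_one]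
  exact key _ hr

/-! ### Permutations commuting with a fixed-point-free involution on six points -/

theorem cycleType_addRight_three : (Equiv.addRight (3 : Fin 6)).cycleType = {2, 2, 2} := by
  have h : orderOf (Equiv.addRight (3 : Fin 6)) = 2 := orderOf_eq_prime (by decide) (by decide)
  obtain ⟨n, hn⟩ := Equiv.Perm.cycleType_prime_order (σ := Equiv.addRight (3 : Fin 6))
    (by rw [h]; exact Nat.prime_two)
  have hs := Equiv.Perm.sum_cycleType (Equiv.addRight (3 : Fin 6))
  have hc : (Equiv.addRight (3 : Fin 6)).support.card = 6 := by decide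
  rw [hn, h, hc] at hs
  rw [hn, h]
  obtain rfl : n = 2 := by simp at hs; omega
  rfl

theorem natCard_centralizer_addRight_three :
    Nat.card (Subgroup.centralizer {Equiv.addRight (3 : Fin 6)}) = 48 := by
  rw [Equiv.Perm.nat_card_centralizer, cycleType_addRight_three]
  rfl

/-- Both involutions have cycle type `{2, 2, 2}`, so they are conjugate, and a conjugating
permutation provides the labelling. The pairs become `{0,3}`, `{1,4}`, `{2,5}`. -/
theorem exists_equiv_fin_six {X : Type*} [Fintype X] (hX : Fintype.card X = 6)
    {c : X → X} (hc : ∀ x, c (c x) = x) (hc' : ∀ x, c x ≠ x) :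
    ∃ e : X ≃ Fin 6, ∀ x, e (c x) = e x + 3 := by
  classical
  let e₀ : X ≃ Fin 6 := Fintype.equivFinOfCardEq hX
  let p : Equiv.Perm X := ⟨c, c, hc, hc⟩
  let q : Equiv.Perm (Fin 6) := e₀.permCongr p
  have hq : ∀ i, q i ≠ i := by
    intro i h
    exact hc' (e₀.symm i) (e₀.injective (by simpa [q, p] using h))
  have hq2 : q ^ 2 = 1 := by
    ext1 i
    simp [q, p, sq, hc]
  have h : orderOf q = 2 := orderOf_eq_prime hq2 (fun h ↦ hq 0 (by rw [h]; rfl))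
  obtain ⟨n, hn⟩ := Equiv.Perm.cycleType_prime_order (σ := q) (by rw [h]; exact Nat.prime_two)
  have hs := Equiv.Perm.sum_cycleType q
  have hsupp : q.support = Finset.univ := by
    ext i
    simpa using hq i
  rw [hn, h, hsupp] at hs
  obtain rfl : n = 2 := by simp at hs; omega
  have hconj : IsConj q (Equiv.addRight (3 : Fin 6)) := by
    rw [Equiv.Perm.isConj_iff_cycleType_eq, cycleType_addRight_three, hn, h]
    rfl
  obtain ⟨g, hg⟩ := isConj_iff.1 hconj
  refine ⟨e₀.trans g, fun x ↦ ?_⟩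
  have := DFunLike.congr_fun hg (g (e₀ x))
  simpa [q, p] using this

theorem swap_mem_of_card {H : Subgroup (Equiv.Perm (Fin 6))}
    (hH : H ≤ Subgroup.centralizer {Equiv.addRight (3 : Fin 6)})
    (hcard : (Nat.card H = 24 ∧ ∀ g ∈ H, ∀ h ∈ H, ⁅g, h⁆ ^ 2 = 1) ∨ Nat.card H = 48)
    (i : Fin 6) : Equiv.swap i (i + 3) ∈ H := by
  have hswap : ∀ i : Fin 6, Equiv.swap i (i + 3) * Equiv.addRight 3 =
    Equiv.addRight 3 * Equiv.swap i (i + 3) := by decide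
  set C := Subgroup.centralizer {Equiv.addRight (3 : Fin 6)} with hC
  have mem_C : ∀ g : Equiv.Perm (Fin 6), g ∈ C ↔
      g * Equiv.addRight 3 = Equiv.addRight 3 * g := by
    intro g
    rw [hC, Subgroup.mem_centralizer_singleton_iff]
  rcases hcard with ⟨h24, hcomm⟩ | h48
  · have hindex : (H.subgroupOf C).index = 2 := by
      have := (H.subgroupOf C).card_mul_index
      rw [natCard_centralizer_addRight_three, Nat.card_congr (Subgroup.subgroupOfEquivOfLe hH).toEquiv,
        h24] at this
      omega
    by_contra hτ
    have hτC : Equiv.swap i (i + 3) ∈ C := (mem_C _).2 (hswap i)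
    -- On the three pairs, `t` is a transposition and `r` a 3-cycle, so the commutator of `r` with
    -- `t`, or with `t` times a swap of one pair, has order 3 there and its square is not 1.
    let t : Equiv.Perm (Fin 6) := Equiv.swap 0 1 * Equiv.swap 3 4
    let r : Equiv.Perm (Fin 6) := Equiv.addRight 2
    have htC : t ∈ C := by rw [mem_C]; decide
    have hrC : r ∈ C := by rw [mem_C]; decide
    -- An index-two subgroup contains all squares, and `r = (r ^ 2) ^ 2` because `r` has order 3.
    have hr : r ∈ H := by
      have := Subgroup.sq_mem_of_index_two hindex ((⟨r, hrC⟩ : C) ^ 2)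
      rw [Subgroup.mem_subgroupOf] at this
      have hr4 : (r ^ 2) ^ 2 = r := by decide
      rwa [SubmonoidClass.coe_pow, SubmonoidClass.coe_pow, hr4] at this
    -- If the swap is outside `H`, exactly one of `t` and `t` times the swap is in `H`; either one
    -- contradicts `hcomm`.
    have hiff := Subgroup.mul_mem_iff_of_index_two hindex (a := (⟨t, htC⟩ : C)) (b := ⟨_, hτC⟩)
    simp only [Subgroup.mem_subgroupOf, Subgroup.coe_mul, hτ, iff_false] at hiff
    by_cases ht : t ∈ H
    · exact absurd (hcomm t ht r hr) (by decide)
    · have hne : ∀ i : Fin 6, ⁅t * Equiv.swap i (i + 3), r⁆ ^ 2 ≠ 1 := by decide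
      exact hne i (hcomm _ (hiff.2 ht) r hr)
  · have : H = C := Subgroup.eq_of_le_of_card_ge hH
      (by rw [h48, natCard_centralizer_addRight_three])
    rw [this, mem_C, hswap]

/-- Swapping exactly the pairs in which `S` contains the larger label carries `S` to `{0, 1, 2}`. -/
theorem exists_prod_swap_mem_iff : ∀ S : Finset (Fin 6), (∀ i, i + 3 ∈ S ↔ i ∉ S) →
    ∃ a b d : Fin 2, ∀ i, i ∈ S ↔
      (Equiv.swap 0 3 ^ (a : ℕ) * Equiv.swap 1 4 ^ (b : ℕ) * Equiv.swap 2 5 ^ (d : ℕ) :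
        Equiv.Perm (Fin 6)) i ∈
        ({0, 1, 2} : Finset (Fin 6)) := by
  decide +kernel

/-- A group of order 24 or 48 acting faithfully on six points and commuting with a
fixed-point-free involution `c` permutes the transversals of `c` transitively. -/
theorem exists_smul_mem_iff {X G : Type*} [Fintype X] (hX : Fintype.card X = 6)
    {c : X → X} (hc : ∀ x, c (c x) = x) (hc' : ∀ x, c x ≠ x)
    [Group G] [MulAction G X] [FaithfulSMul G X] (hcomm : ∀ (g : G) x, g • c x = c (g • x))
    (hG : Nonempty (G ≃* C2CubedC3) ∨ Nonempty (G ≃* C2CubedS3))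
    {S T : Set X} (hS : ∀ x, c x ∈ S ↔ x ∉ S) (hT : ∀ x, c x ∈ T ↔ x ∉ T) :
    ∃ g : G, ∀ x, x ∈ S ↔ g • x ∈ T := by
  classical
  obtain ⟨e, he⟩ := exists_equiv_fin_six hX hc hc'
  let f : G →* Equiv.Perm (Fin 6) :=
    (e.permCongrHom : Equiv.Perm X →* Equiv.Perm (Fin 6)).comp (MulAction.toPermHom G X)
  have hf : ∀ g x, f g (e x) = e (g • x) := by
    intro g x
    simp [f]
  have hinj : Function.Injective f :=
    e.permCongrHom.injective.comp MulAction.toPerm_injective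
  have hrange : f.range ≤ Subgroup.centralizer {Equiv.addRight (3 : Fin 6)} := by
    rintro _ ⟨g, rfl⟩
    rw [Subgroup.mem_centralizer_singleton_iff]
    ext1 i
    obtain ⟨x, rfl⟩ := e.surjective i
    simp only [Equiv.Perm.mul_apply, Equiv.coe_addRight, ← he, hf, hcomm]
  have hcard : Nat.card f.range = Nat.card G :=
    (Nat.card_congr (MonoidHom.ofInjective hinj).toEquiv).symm
  have hswap : ∀ i, Equiv.swap i (i + 3) ∈ f.range := by
    refine swap_mem_of_card hrange ?_
    rcases hG with ⟨⟨m⟩⟩ | ⟨⟨m⟩⟩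
    · left
      refine ⟨by rw [hcard, Nat.card_congr m.toEquiv, natCard_C2CubedC3], ?_⟩
      rintro _ ⟨g, rfl⟩ _ ⟨h, rfl⟩
      have : ⁅g, h⁆ ^ 2 = 1 := m.injective
        (by rw [map_pow, map_commutatorElement, commutatorElement_sq_C2CubedC3, map_one])
      rw [← map_commutatorElement, ← map_pow, this, map_one]
    · right
      rw [hcard, Nat.card_congr m.toEquiv, natCard_C2CubedS3]
  -- Every transversal can be moved to the standard one `{0, 1, 2}`; `S` is sent to `T` by passing
  -- through it.
  have key : ∀ U : Set X, (∀ x, c x ∈ U ↔ x ∉ U) →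
      ∃ g : G, ∀ x, x ∈ U ↔ e (g • x) ∈ ({0, 1, 2} : Finset (Fin 6)) := by
    intro U hU
    obtain ⟨a, b, d, h⟩ := exists_prod_swap_mem_iff
      (Finset.univ.filter (fun i ↦ e.symm i ∈ U)) (by
        intro i
        obtain ⟨x, rfl⟩ := e.surjective i
        simpa [← he] using hU x)
    obtain ⟨g, hg⟩ : (Equiv.swap (0 : Fin 6) 3 ^ (a : ℕ) * Equiv.swap 1 4 ^ (b : ℕ) *
        Equiv.swap 2 5 ^ (d : ℕ)) ∈ f.range :=
      mul_mem (mul_mem (pow_mem (hswap 0) _) (pow_mem (hswap 1) _)) (pow_mem (hswap 2) _)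
    refine ⟨g, fun x ↦ ?_⟩
    have := h (e x)
    rw [← hg, hf] at this
    simpa using this
  obtain ⟨g, hg⟩ := key S hS
  obtain ⟨h, hh⟩ := key T hT
  refine ⟨h⁻¹ * g, fun x ↦ ?_⟩
  rw [hg, hh, mul_smul, smul_inv_smul]

open Classical in
/-- The product of `∏_{x ∈ S} f x` over the four transversals `S` of a fixed-point-free involution
`c` on six points that contain a given point. -/
theorem prod_transversals {X M : Type*} [Fintype X] [CommSemiring M] (hX : Fintype.card X = 6)
    {c : X → X} (hc : ∀ x, c (c x) = x) (hc' : ∀ x, c x ≠ x) (x₀ : X) (f : X → M) :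
    (∏ S ∈ (Finset.univ : Finset (Finset X)).filter (fun S ↦ (∀ x, c x ∈ S ↔ x ∉ S) ∧ x₀ ∈ S),
      ∏ x ∈ S, f x) * f (c x₀) ^ 2 = (∏ x, f x) ^ 2 * f x₀ ^ 2 := by
  obtain ⟨e₁, he₁⟩ := exists_equiv_fin_six hX hc hc'
  -- Translating the labels puts `x₀` at 0 and preserves the rule that `c` adds 3.
  let e : X ≃ Fin 6 := e₁.trans (Equiv.subRight (e₁ x₀))
  have he : ∀ x, e (c x) = e x + 3 := by
    intro x
    simp only [e, Equiv.trans_apply, Equiv.subRight_apply, he₁]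
    exact add_sub_right_comm _ _ _
  have he0 : e x₀ = 0 := by simp [e]
  -- A transversal containing 0 is fixed by choosing 1 or 4 and 2 or 5.
  have h1 : (Finset.univ : Finset (Finset X)).filter (fun S ↦ (∀ x, c x ∈ S ↔ x ∉ S) ∧ x₀ ∈ S) =
      (({{0, 1, 2}, {0, 1, 5}, {0, 4, 2}, {0, 4, 5}} : Finset (Finset (Fin 6)))).map
        e.symm.finsetCongr.toEmbedding := by
    have h2 : ({{0, 1, 2}, {0, 1, 5}, {0, 4, 2}, {0, 4, 5}} : Finset (Finset (Fin 6))) =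
        Finset.univ.filter (fun S ↦ (∀ i : Fin 6, i + 3 ∈ S ↔ i ∉ S) ∧ 0 ∈ S) := by
      decide +kernel
    rw [h2]
    ext S
    simp only [Finset.mem_filter, Finset.mem_univ, true_and, Finset.mem_map_equiv]
    simp [Finset.mem_map_equiv, e.symm.forall_congr_left, ← he, ← he0]
  have h3 : e.symm 0 = x₀ := by rw [← he0]; simp
  have h4 : e.symm 3 = c x₀ := by rw [e.symm_apply_eq, he, he0, zero_add]
  rw [h1, Finset.prod_map, ← e.symm.prod_comp, Fin.prod_univ_six]
  rw [Finset.prod_insert (by decide), Finset.prod_insert (by decide),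
    Finset.prod_insert (by decide), Finset.prod_singleton]
  simp only [Equiv.coe_toEmbedding, Equiv.finsetCongr_apply, Finset.prod_map]
  rw [Finset.prod_insert (by decide), Finset.prod_insert (by decide), Finset.prod_singleton,
    Finset.prod_insert (by decide), Finset.prod_insert (by decide), Finset.prod_singleton,
    Finset.prod_insert (by decide), Finset.prod_insert (by decide), Finset.prod_singleton,
    Finset.prod_insert (by decide), Finset.prod_insert (by decide), Finset.prod_singleton]
  rw [h3, h4]
  ring

/-! ### Extension and contraction of fractional ideals -/

section Ideals

open FractionalIdeal

variable {E F L : Type*} [Field E] [NumberField E] [Field F] [NumberField F]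
  [Field L] [NumberField L]

theorem mapIdeal_mapIdeal (f : E →+* F) (g : F →+* L) (I : FractionalIdeal (𝓞 E)⁰ E) :
    mapIdeal g (mapIdeal f I) = mapIdeal (g.comp f) I :=
  extended_extended (f := RingOfIntegers.mapRingHom f) (g := RingOfIntegers.mapRingHom g)
    (L := F) (W := L) (N := (𝓞 F)⁰) (P := (𝓞 L)⁰) _ I _

theorem mapIdeal_coeIdeal (f : E →+* F) (I : Ideal (𝓞 E)) :
    mapIdeal f (I : FractionalIdeal (𝓞 E)⁰ E) =
      ((I.map (RingOfIntegers.mapRingHom f) : Ideal (𝓞 F)) : FractionalIdeal (𝓞 F)⁰ F) :=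
  extended_coeIdeal_eq_map _ _ _

theorem mem_mapIdeal_of_mem (f : E →+* F) {I : FractionalIdeal (𝓞 E)⁰ E} {x : E} (hx : x ∈ I) :
    f x ∈ mapIdeal f I := by
  rw [← mem_coe, coe_mapIdeal]
  exact Submodule.subset_span ⟨x, hx, rfl⟩

theorem mapIdeal_le_iff (f : E →+* F) {I : FractionalIdeal (𝓞 E)⁰ E}
    {J : FractionalIdeal (𝓞 F)⁰ F} : mapIdeal f I ≤ J ↔ ∀ x ∈ I, f x ∈ J := by
  rw [← coe_le_coe, coe_mapIdeal, Submodule.span_le, Set.image_subset_iff]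
  rfl

theorem mem_one_iff_isIntegral {F : Type*} [Field F] {x : F} :
    x ∈ (1 : FractionalIdeal (𝓞 F)⁰ F) ↔ IsIntegral ℤ x := by
  rw [mem_one_iff]
  exact ⟨fun ⟨y, hy⟩ ↦ hy ▸ RingOfIntegers.isIntegral_coe y, fun h ↦ ⟨⟨x, h⟩, rfl⟩⟩

theorem mapIdeal_le_one_iff (f : E →+* F) {I : FractionalIdeal (𝓞 E)⁰ E} :
    mapIdeal f I ≤ 1 ↔ I ≤ 1 := by
  rw [mapIdeal_le_iff]
  refine forall₂_congr fun x _ ↦ ?_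
  rw [mem_one_iff_isIntegral, mem_one_iff_isIntegral,
    ← isIntegral_algHom_iff f.toIntAlgHom f.injective]
  rfl

/-- If `x` lies in the extension of `I`, then `x I⁻¹` extends to an integral ideal. An embedding
reflects integrality, so `x I⁻¹` is integral and `x ∈ I`. -/
theorem contract_mapIdeal [Algebra F L] (I : (FractionalIdeal (𝓞 F)⁰ F)ˣ) :
    contract F (mapIdeal (algebraMap F L) (I : FractionalIdeal (𝓞 F)⁰ F)) = I := by
  refine le_antisymm (fun x hx ↦ ?_) fun x hx ↦ mem_mapIdeal_of_mem _ hx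
  have h : spanSingleton (𝓞 F)⁰ x * (I : FractionalIdeal (𝓞 F)⁰ F)⁻¹ ≤ 1 := by
    rw [← mapIdeal_le_one_iff (algebraMap F L), map_mul, map_inv₀, mapIdeal_spanSingleton]
    refine (mul_le_mul_left (spanSingleton_le_iff_mem.2 (mem_contract.1 hx)) _).trans_eq ?_
    exact mul_inv_cancel₀ ((_root_.map_ne_zero _).2 I.ne_zero)
  have := mul_le_mul_left h (I : FractionalIdeal (𝓞 F)⁰ F)
  rwa [mul_assoc, inv_mul_cancel₀ I.ne_zero, mul_one, one_mul, spanSingleton_le_iff_mem] at this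

theorem mapIdeal_contract_le [Algebra F L] (J : FractionalIdeal (𝓞 L)⁰ L) :
    mapIdeal (algebraMap F L) (contract F J) ≤ J :=
  (mapIdeal_le_iff _).2 fun _ hx ↦ hx

/-! ### Powers of fractional ideals -/

theorem le_one_of_pow_eq_one {I : FractionalIdeal (𝓞 F)⁰ F} {n : ℕ} (hn : n ≠ 0)
    (h : I ^ n = 1) : I ≤ 1 := by
  intro x hx
  rw [mem_one_iff_isIntegral]
  have hx' : spanSingleton (𝓞 F)⁰ x ^ n ≤ 1 := h ▸ pow_le_pow_left' (spanSingleton_le_iff_mem.2 hx) n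
  rw [spanSingleton_pow, spanSingleton_le_iff_mem, mem_one_iff_isIntegral] at hx'
  exact hx'.of_pow (Nat.pos_of_ne_zero hn)

theorem eq_one_of_pow_eq_one {I : FractionalIdeal (𝓞 F)⁰ F} {n : ℕ} (hn : n ≠ 0)
    (h : I ^ n = 1) : I = 1 := by
  have hI : I ≠ 0 := by
    rintro rfl
    simp [hn] at h
  refine le_antisymm (le_one_of_pow_eq_one hn h) ?_
  have h1 : I⁻¹ ≤ 1 := le_one_of_pow_eq_one hn (by rw [inv_pow, h, inv_one])
  have := mul_le_mul_left h1 I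
  rwa [inv_mul_cancel₀ hI, one_mul] at this

/-- Allows an ideal identity to be checked after raising to a power that makes the ideal principal.
-/
theorem eq_of_pow_eq_pow {I J : FractionalIdeal (𝓞 F)⁰ F} (hJ : J ≠ 0) {n : ℕ} (hn : n ≠ 0)
    (h : I ^ n = J ^ n) : I = J := by
  rw [← div_eq_one_iff_eq hJ]
  refine eq_one_of_pow_eq_one hn ?_
  rw [div_pow, h, div_self (pow_ne_zero n hJ)]

theorem exists_pow_eq_spanSingleton (a : (FractionalIdeal (𝓞 F)⁰ F)ˣ) :
    ∃ n ≠ 0, ∃ x : F, (a : FractionalIdeal (𝓞 F)⁰ F) ^ n = spanSingleton (𝓞 F)⁰ x := by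
  have h : ClassGroup.mk F (a ^ Fintype.card (ClassGroup (𝓞 F))) = 1 := by
    rw [map_pow, pow_card_eq_one]
  rw [ClassGroup.mk_eq_one_iff] at h
  refine ⟨Fintype.card (ClassGroup (𝓞 F)), Fintype.card_ne_zero, ?_⟩
  obtain ⟨x, hx⟩ := (isPrincipal_iff _).1 h
  exact ⟨x, by rw [← hx, Units.val_pow_eq_pow_val]⟩

/-- Every nonzero fractional ideal is generated by one element up to a factor prime to a given
nonzero ideal. -/
theorem exists_spanSingleton_eq_mul (a : (FractionalIdeal (𝓞 F)⁰ F)ˣ) {m : Ideal (𝓞 F)}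
    (hm : m ≠ ⊥) : ∃ (x : F) (b : Ideal (𝓞 F)), m ⊔ b = ⊤ ∧
      spanSingleton (𝓞 F)⁰ x = a * (b : FractionalIdeal (𝓞 F)⁰ F) := by
  obtain ⟨d, a₀, hd, ha⟩ := exists_eq_spanSingleton_mul (a : FractionalIdeal (𝓞 F)⁰ F)
  have ha₀ : a₀ ≠ ⊥ := by
    rintro rfl
    exact a.ne_zero (by rw [ha]; simp)
  -- Here `m a₀ + (α) = a₀`. Writing `(α) = a₀ b` and cancelling `a₀` gives `m + b = 1`.
  obtain ⟨α, hα⟩ := IsDedekindDomain.exists_sup_span_eq (Ideal.mul_le_right (I := m) (J := a₀))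
    (mul_ne_zero hm ha₀)
  have hle : Ideal.span {α} ≤ a₀ := le_sup_right.trans_eq hα
  obtain ⟨b, hb⟩ := Ideal.dvd_iff_le.2 hle
  refine ⟨(algebraMap (𝓞 F) F d)⁻¹ * algebraMap (𝓞 F) F α, b, ?_, ?_⟩
  · rw [hb, mul_comm m, ← Ideal.mul_sup] at hα
    exact mul_left_cancel₀ ha₀ (hα.trans (Ideal.mul_top a₀).symm)
  · rw [ha, mul_assoc, ← coeIdeal_mul, ← hb, coeIdeal_span_singleton,
      spanSingleton_mul_spanSingleton]

end Ideals

/-! ### Descent of type norms, and the absolute norm as a product of conjugates -/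

section TypeNorm

open FractionalIdeal

variable {E F L : Type*} [Field E] [NumberField E] [Field F] [NumberField F]
  [Field L] [NumberField L]

theorem typeNormL_apply (Ψ : Set (E →ₐ[ℚ] L)) (a : FractionalIdeal (𝓞 E)⁰ E) :
    typeNormL Ψ a = ∏ ψ ∈ (Set.toFinite Ψ).toFinset, mapIdeal (ψ : E →+* L) a := by
  rw [typeNormL, MonoidHom.finsetProd_apply]
  rfl

theorem typeNormL_ne_zero (Ψ : Set (E →ₐ[ℚ] L)) (a : (FractionalIdeal (𝓞 E)⁰ E)ˣ) :
    typeNormL Ψ (a : FractionalIdeal (𝓞 E)⁰ E) ≠ 0 :=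
  (Units.map (typeNormL Ψ) a).ne_zero

/-- If the type norm of elements takes values in `F`, then the type norm of an ideal is extended
from `F`. -/
theorem mapIdeal_typeNorm [Algebra F L] (Ψ : Set (E →ₐ[ℚ] L))
    (hΨ : ∀ x : E, ∃ y : F, algebraMap F L y = ∏ ψ ∈ (Set.toFinite Ψ).toFinset, ψ x)
    (a : (FractionalIdeal (𝓞 E)⁰ E)ˣ) :
    mapIdeal (algebraMap F L) (typeNorm F Ψ a) = typeNormL Ψ (a : FractionalIdeal (𝓞 E)⁰ E) := by
  set J := typeNormL Ψ (a : FractionalIdeal (𝓞 E)⁰ E) with hJ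
  have hJ0 : J ≠ 0 := typeNormL_ne_zero Ψ a
  set J' := mapIdeal (algebraMap F L) (typeNorm F Ψ a)
  have hle : J' * J⁻¹ ≤ 1 :=
    (mul_le_mul_left (mapIdeal_contract_le J) _).trans_eq (mul_inv_cancel₀ hJ0)
  -- `I` measures the loss under contraction; a maximal ideal `P` containing it will be excluded.
  obtain ⟨I, hI⟩ := le_one_iff_exists_coeIdeal.1 hle
  suffices hIt : I = ⊤ by
    rw [hIt, coeIdeal_top] at hI
    exact (eq_mul_inv_iff_mul_eq₀ hJ0).1 hI ▸ one_mul J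
  by_contra hIt
  obtain ⟨P, hP, hIP⟩ := Ideal.exists_le_maximal I hIt
  have hJ'0 : J' ≠ 0 := (_root_.map_ne_zero _).2 (typeNorm_ne_zero Ψ a)
  have hP0 : P ≠ ⊥ := by
    rintro rfl
    rw [le_bot_iff.1 hIP, coeIdeal_bot] at hI
    exact mul_ne_zero hJ'0 (inv_ne_zero hJ0) hI.symm
  -- An ideal prime to `m` is prime to every `ψ⁻¹(P)`, so none of its images under `ψ` lies in `P`.
  let m : Ideal (𝓞 E) := ∏ ψ ∈ (Set.toFinite Ψ).toFinset,
    P.comap (RingOfIntegers.mapRingHom (ψ : E →+* L))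
  have hm : m ≠ ⊥ := by
    rw [← Ideal.zero_eq_bot, Finset.prod_ne_zero_iff]
    intro ψ _ h
    have hmem : ((Ideal.absNorm P : ℕ) : 𝓞 E) ∈
        P.comap (RingOfIntegers.mapRingHom (ψ : E →+* L)) := by
      rw [Ideal.mem_comap, map_natCast]
      exact Ideal.absNorm_mem P
    rw [h, Ideal.zero_eq_bot, Ideal.mem_bot, Nat.cast_eq_zero, Ideal.absNorm_eq_zero_iff] at hmem
    exact hP0 hmem
  obtain ⟨x, b, hb, hx⟩ := exists_spanSingleton_eq_mul a hm
  obtain ⟨y, hy⟩ := hΨ x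
  have hxJ : spanSingleton (𝓞 L)⁰ (algebraMap F L y) = J * typeNormL Ψ (b : FractionalIdeal _ E) := by
    rw [hy, ← typeNormL_spanSingleton, hx, map_mul]
  -- The type norm of `x` is an element of `F` lying in `J`, so it already lies in `J'`; dividing by
  -- `J` leaves the type norm of `b`.
  have hbI : typeNormL Ψ (b : FractionalIdeal (𝓞 E)⁰ E) ≤ (I : FractionalIdeal (𝓞 L)⁰ L) := by
    have h1 : spanSingleton (𝓞 L)⁰ (algebraMap F L y) ≤ J' := by
      refine spanSingleton_le_iff_mem.2 (mem_mapIdeal_of_mem _ (mem_contract.2 ?_))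
      rw [← spanSingleton_le_iff_mem, hxJ]
      refine (mul_le_mul_right ?_ J).trans_eq (mul_one J)
      rw [typeNormL_apply]
      exact Finset.prod_le_one' fun ψ _ ↦ (mapIdeal_le_one_iff _).2 coeIdeal_le_one
    rw [hI]
    calc typeNormL Ψ (b : FractionalIdeal (𝓞 E)⁰ E)
        = spanSingleton (𝓞 L)⁰ (algebraMap F L y) * J⁻¹ := by
          rw [hxJ, mul_comm J, mul_assoc, mul_inv_cancel₀ hJ0, mul_one]
      _ ≤ J' * J⁻¹ := mul_le_mul_left h1 _
  have hprod : ∏ ψ ∈ (Set.toFinite Ψ).toFinset,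
      b.map (RingOfIntegers.mapRingHom (ψ : E →+* L)) ≤ P := by
    refine le_trans ?_ hIP
    rw [← coeIdeal_le_coeIdeal L]
    refine le_trans (le_of_eq ?_) hbI
    rw [typeNormL_apply, ← coeIdealHom_apply, map_prod]
    exact Finset.prod_congr rfl fun ψ _ ↦ (mapIdeal_coeIdeal _ _).symm
  obtain ⟨ψ, hψ, hψP⟩ := (Ideal.IsPrime.prod_le hP.isPrime).1 hprod
  have htop : (⊤ : Ideal (𝓞 L)) ≤ P := by
    rw [← Ideal.map_top (RingOfIntegers.mapRingHom (ψ : E →+* L)), ← hb, Ideal.map_sup]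
    refine sup_le ?_ hψP
    rw [Ideal.map_le_iff_le_comap]
    exact (Ideal.prod_le_inf).trans (Finset.inf_le hψ)
  exact hP.ne_top (top_le_iff.1 htop)

/-- By normality, all embeddings into an algebraic closure already land in `L`. -/
theorem algebraMap_norm_eq_prod [IsNormalClosure ℚ E L] (x : E) :
    algebraMap ℚ L (Algebra.norm ℚ x) = ∏ φ : E →ₐ[ℚ] L, φ x := by
  apply (algebraMap L (AlgebraicClosure L)).injective
  rw [map_prod, ← IsScalarTower.algebraMap_apply, Algebra.norm_eq_prod_embeddings ℚ (AlgebraicClosure L)]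
  have hinj : Function.Injective
      (fun φ : E →ₐ[ℚ] L ↦ (IsScalarTower.toAlgHom ℚ L (AlgebraicClosure L)).comp φ) :=
    fun φ φ' h ↦ AlgHom.ext fun z ↦
      (algebraMap L (AlgebraicClosure L)).injective (DFunLike.congr_fun h z)
  have hbij := (Fintype.bijective_iff_injective_and_card _).2 ⟨hinj, by
    rw [AlgHom.card_of_splits ℚ E L IsNormalClosure.splits, AlgHom.card]⟩
  exact (Fintype.prod_bijective _ hbij _ _ fun φ ↦ rfl).symm

/-- The absolute norm of `a`, extended to `L`, is the product of all conjugates of `a`. -/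
theorem spanSingleton_absNorm [IsNormalClosure ℚ E L] (a : (FractionalIdeal (𝓞 E)⁰ E)ˣ) :
    spanSingleton (𝓞 L)⁰ ((absNorm (a : FractionalIdeal (𝓞 E)⁰ E) : ℚ) : L) =
      ∏ φ : E →ₐ[ℚ] L, mapIdeal (φ : E →+* L) (a : FractionalIdeal (𝓞 E)⁰ E) := by
  obtain ⟨n, hn, x, hx⟩ := exists_pow_eq_spanSingleton a
  refine eq_of_pow_eq_pow (Finset.prod_ne_zero_iff.2 fun φ _ ↦ (_root_.map_ne_zero _).2 a.ne_zero) hn ?_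
  -- The absolute norm of a principal ideal is the norm up to sign, and a sign does not change the
  -- ideal.
  have h1 : spanSingleton (𝓞 L)⁰ ((|Algebra.norm ℚ x| : ℚ) : L) =
      spanSingleton (𝓞 L)⁰ (∏ φ : E →ₐ[ℚ] L, φ x) := by
    rw [← algebraMap_norm_eq_prod, eq_ratCast]
    rcases abs_choice (Algebra.norm ℚ x) with h | h
    · rw [h]
    · rw [h, Rat.cast_neg]
      refine le_antisymm ?_ ?_ <;> rw [spanSingleton_le_iff_mem]
      · exact (neg_mem_iff (S := Submodule (𝓞 L) L)).2 (mem_spanSingleton_self _ _)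
      · have := mem_spanSingleton_self (𝓞 L)⁰ (-((Algebra.norm ℚ x : ℚ) : L))
        exact (neg_mem_iff (S := Submodule (𝓞 L) L)).1 this
  rw [spanSingleton_pow, ← Rat.cast_pow, ← map_pow, hx, absNorm_span_singleton, h1,
    ← Finset.prod_pow]
  have h2 := typeNormL_spanSingleton (Set.univ : Set (E →ₐ[ℚ] L)) x
  rw [typeNormL_apply] at h2
  simp only [Set.toFinite_toFinset, Set.toFinset_univ] at h2
  rw [← h2]
  exact Finset.prod_congr rfl fun φ _ ↦ by rw [← map_pow, hx]

end TypeNorm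

/-! ### Embeddings, CM types and reflex types -/

section CMTypes

variable {K L : Type*} [Field K] [NumberField K] [Field L] [NumberField L]

theorem conj_conj [IsCMField K] (x : K) : conj K (conj K x) = x :=
  IsCMField.complexConj_apply_apply K x

theorem comp_conj_comp_conj [IsCMField K] (χ : K →ₐ[ℚ] L) :
    (χ.comp (conj K)).comp (conj K) = χ :=
  AlgHom.ext fun x ↦ congrArg χ (conj_conj x)

theorem comp_conj_ne [IsCMField K] (χ : K →ₐ[ℚ] L) : χ.comp (conj K) ≠ χ := fun h ↦
  IsCMField.complexConj_ne_one K (AlgEquiv.ext fun x ↦ χ.injective (DFunLike.congr_fun h x))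

theorem isCMType_iff [IsCMField K] {Φ : Set (K →ₐ[ℚ] L)} :
    IsCMType Φ ↔ ∀ χ, χ.comp (conj K) ∈ Φ ↔ χ ∉ Φ := by
  have hmem : ∀ χ : K →ₐ[ℚ] L, χ ∈ (fun φ ↦ φ.comp (conj K)) '' Φ ↔ χ.comp (conj K) ∈ Φ := by
    refine fun χ ↦ ⟨?_, fun h ↦ ⟨_, h, comp_conj_comp_conj χ⟩⟩
    rintro ⟨φ, hφ, rfl⟩
    rwa [comp_conj_comp_conj]
  rw [IsCMType, ← eq_compl_iff_isCompl, Set.ext_iff]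
  refine forall_congr' fun χ ↦ ?_
  rw [Set.mem_compl_iff, hmem]
  tauto

/-- The action of `Gal(L/ℚ)` on the embeddings `K → L`. -/
abbrev embeddingAction (K L : Type*) [Field K] [NumberField K] [Field L] [NumberField L] :
    MulAction (L ≃ₐ[ℚ] L) (K →ₐ[ℚ] L) where
  smul g χ := (g : L →ₐ[ℚ] L).comp χ
  one_smul _ := rfl
  mul_smul _ _ _ := rfl

/-- The images of the embeddings generate `L`, and `g⁻¹ h` fixes all of them. Hence the Galois
action on embeddings is faithful. -/
theorem eq_of_forall_comp_eq [IsNormalClosure ℚ K L] {g h : L ≃ₐ[ℚ] L}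
    (hgh : ∀ χ : K →ₐ[ℚ] L, (g : L →ₐ[ℚ] L).comp χ = (h : L →ₐ[ℚ] L).comp χ) : g = h := by
  have htop : IntermediateField.normalClosure ℚ K L = ⊤ :=
    (Algebra.IsAlgebraic.isNormalClosure_iff.1 inferInstance).2
  have hle : (⊤ : IntermediateField ℚ L) ≤
      IntermediateField.fixedField (Subgroup.zpowers (g⁻¹ * h)) := by
    rw [← htop, normalClosure_le_iff]
    intro χ
    rw [IntermediateField.le_iff_le, Subgroup.zpowers_le, IntermediateField.mem_fixingSubgroup_iff]
    rintro _ ⟨x, rfl⟩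
    exact (congrArg g.symm (DFunLike.congr_fun (hgh χ) x)).symm.trans (g.symm_apply_apply _)
  ext x
  have hx := (IntermediateField.mem_fixedField_iff _ x).1 (hle IntermediateField.mem_top) _
    (Subgroup.mem_zpowers _)
  exact (congrArg g hx).symm.trans (g.apply_symm_apply (h x))

theorem card_algHom_eq_finrank [IsNormalClosure ℚ K L] :
    Fintype.card (K →ₐ[ℚ] L) = Module.finrank ℚ K :=
  AlgHom.card_of_splits ℚ K L IsNormalClosure.splits

/-- `Gal(L/ℚ)` permutes the CM types of `K` transitively. -/
theorem exists_comp_mem_iff [IsCMField K] [IsNormalClosure ℚ K L] (hK : Module.finrank ℚ K = 6)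
    (hG : Nonempty ((L ≃ₐ[ℚ] L) ≃* C2CubedC3) ∨ Nonempty ((L ≃ₐ[ℚ] L) ≃* C2CubedS3))
    {S T : Set (K →ₐ[ℚ] L)} (hS : IsCMType S) (hT : IsCMType T) :
    ∃ g : L ≃ₐ[ℚ] L, ∀ χ, χ ∈ S ↔ (g : L →ₐ[ℚ] L).comp χ ∈ T := by
  let := embeddingAction K L
  have : FaithfulSMul (L ≃ₐ[ℚ] L) (K →ₐ[ℚ] L) := ⟨fun h ↦ eq_of_forall_comp_eq h⟩
  exact exists_smul_mem_iff (card_algHom_eq_finrank.trans hK) (c := fun χ ↦ χ.comp (conj K))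
    comp_conj_comp_conj comp_conj_ne (fun _ _ ↦ rfl) hG (isCMType_iff.1 hS) (isCMType_iff.1 hT)

variable [Algebra K L]

theorem exists_comp_toAlgHom_eq [IsGalois ℚ L] (χ : K →ₐ[ℚ] L) :
    ∃ g : L ≃ₐ[ℚ] L, (g : L →ₐ[ℚ] L).comp (IsScalarTower.toAlgHom ℚ K L) = χ :=
  ⟨AlgEquiv.ofBijective (χ.liftNormal L) (AlgHom.normal_bijective ℚ L L _),
    AlgHom.ext fun x ↦ χ.liftNormal_commutes L x⟩

/-- Every embedding of `K` extends to an automorphism of `L`, so stabilizing `Φ_L` is the same as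
stabilizing `Φ`. -/
theorem mem_stabilizer_liftType_iff [IsGalois ℚ L] {Φ : Set (K →ₐ[ℚ] L)} {g : L ≃ₐ[ℚ] L} :
    g ∈ MulAction.stabilizer (L ≃ₐ[ℚ] L) (liftType Φ) ↔
      ∀ χ, χ ∈ Φ ↔ (g : L →ₐ[ℚ] L).comp χ ∈ Φ := by
  rw [MulAction.mem_stabilizer_iff]
  constructor
  · intro h χ
    obtain ⟨u, rfl⟩ := exists_comp_toAlgHom_eq χ
    have := Set.smul_mem_smul_set_iff (a := g) (s := liftType Φ) (x := u)
    rw [h] at this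
    exact this.symm
  · intro h
    ext u
    rw [Set.mem_smul_set_iff_inv_smul_mem]
    refine (h _).trans ?_
    have h2 : (g : L →ₐ[ℚ] L).comp (((g⁻¹ • u : L ≃ₐ[ℚ] L) : L →ₐ[ℚ] L).comp
        (IsScalarTower.toAlgHom ℚ K L)) =
        (u : L →ₐ[ℚ] L).comp (IsScalarTower.toAlgHom ℚ K L) :=
      AlgHom.ext fun x ↦ g.apply_symm_apply (u (algebraMap K L x))
    rw [h2]
    rfl

/-- The restriction of `σ ∈ Gal(L/ℚ)` to the reflex field. -/
def reflexRestrict (Φ : Set (K →ₐ[ℚ] L)) (σ : L ≃ₐ[ℚ] L) : reflexField Φ →ₐ[ℚ] L :=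
  (σ : L →ₐ[ℚ] L).comp (reflexField Φ).val

theorem mem_reflexType_iff {Φ : Set (K →ₐ[ℚ] L)} {ψ : reflexField Φ →ₐ[ℚ] L} :
    ψ ∈ reflexType Φ ↔ ∃ σ : L ≃ₐ[ℚ] L,
      ((σ⁻¹ : L ≃ₐ[ℚ] L) : L →ₐ[ℚ] L).comp (IsScalarTower.toAlgHom ℚ K L) ∈ Φ ∧
        reflexRestrict Φ σ = ψ :=
  Iff.rfl

/-- The right side says `σΦ = τΦ`. By the Galois correspondence, agreement on `K^r` means that
`τ⁻¹σ` stabilizes `Φ`. -/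
theorem reflexRestrict_eq_iff [IsGalois ℚ L] {Φ : Set (K →ₐ[ℚ] L)} {σ τ : L ≃ₐ[ℚ] L} :
    reflexRestrict Φ σ = reflexRestrict Φ τ ↔
      ∀ χ, ((σ⁻¹ : L ≃ₐ[ℚ] L) : L →ₐ[ℚ] L).comp χ ∈ Φ ↔
        ((τ⁻¹ : L ≃ₐ[ℚ] L) : L →ₐ[ℚ] L).comp χ ∈ Φ := by
  have h1 : reflexRestrict Φ σ = reflexRestrict Φ τ ↔ τ⁻¹ * σ ∈ (reflexField Φ).fixingSubgroup := by
    rw [IntermediateField.mem_fixingSubgroup_iff]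
    constructor
    · intro h x hx
      exact (congrArg τ.symm (DFunLike.congr_fun h ⟨x, hx⟩)).trans (τ.symm_apply_apply x)
    · intro h
      ext x
      exact (τ.apply_symm_apply _).symm.trans (congrArg τ (h x x.2))
  rw [h1, reflexField, IntermediateField.fixingSubgroup_fixedField, mem_stabilizer_liftType_iff]
  constructor
  · intro h χ
    have := h (((σ⁻¹ : L ≃ₐ[ℚ] L) : L →ₐ[ℚ] L).comp χ)
    rw [this]
    have h2 : ((τ⁻¹ * σ : L ≃ₐ[ℚ] L) : L →ₐ[ℚ] L).comp
        (((σ⁻¹ : L ≃ₐ[ℚ] L) : L →ₐ[ℚ] L).comp χ) =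
        ((τ⁻¹ : L ≃ₐ[ℚ] L) : L →ₐ[ℚ] L).comp χ :=
      AlgHom.ext fun x ↦ congrArg τ.symm (σ.apply_symm_apply (χ x))
    rw [h2]
  · intro h χ
    have := h ((σ : L →ₐ[ℚ] L).comp χ)
    rwa [show ((σ⁻¹ : L ≃ₐ[ℚ] L) : L →ₐ[ℚ] L).comp ((σ : L →ₐ[ℚ] L).comp χ) = χ from
      AlgHom.ext fun x ↦ σ.symm_apply_apply (χ x)] at this

/-- The type norm of an element of `K` lies in the reflex field. -/
theorem exists_algebraMap_eq_prod [IsGalois ℚ L] (Φ : Set (K →ₐ[ℚ] L)) (x : K) :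
    ∃ y : reflexField Φ,
      algebraMap (reflexField Φ) L y = ∏ φ ∈ (Set.toFinite Φ).toFinset, φ x := by
  refine ⟨⟨∏ φ ∈ (Set.toFinite Φ).toFinset, φ x, ?_⟩, rfl⟩
  rw [reflexField, IntermediateField.mem_fixedField_iff]
  intro g hg
  have hg' := mem_stabilizer_liftType_iff.1 hg
  have hginv := mem_stabilizer_liftType_iff.1 (inv_mem hg)
  rw [map_prod]
  refine Finset.prod_bij' (fun φ _ ↦ (g : L →ₐ[ℚ] L).comp φ)
    (fun φ _ ↦ ((g⁻¹ : L ≃ₐ[ℚ] L) : L →ₐ[ℚ] L).comp φ) ?_ ?_ ?_ ?_ ?_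
  · intro φ hφ
    simpa using (hg' φ).1 (by simpa using hφ)
  · intro φ hφ
    simpa using (hginv φ).1 (by simpa using hφ)
  · intro φ _
    ext z
    exact g.symm_apply_apply (φ z)
  · intro φ _
    ext z
    exact g.apply_symm_apply (φ z)
  · intro φ _
    rfl

-- Extended to `L`, the type norm is the full product over `Φ` by `mapIdeal_typeNorm`; applying `σ`
-- turns it into the product over `σΦ`.
open Classical in
theorem mapIdeal_reflexRestrict_typeNorm [IsGalois ℚ L] (Φ : Set (K →ₐ[ℚ] L)) (σ : L ≃ₐ[ℚ] L)
    (a : (FractionalIdeal (𝓞 K)⁰ K)ˣ) :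
    mapIdeal (reflexRestrict Φ σ : reflexField Φ →+* L)
        (typeNorm (reflexField Φ) Φ (a : FractionalIdeal (𝓞 K)⁰ K)) =
      ∏ χ ∈ Finset.univ.filter (fun χ ↦ ((σ⁻¹ : L ≃ₐ[ℚ] L) : L →ₐ[ℚ] L).comp χ ∈ Φ),
        mapIdeal (χ : K →+* L) (a : FractionalIdeal (𝓞 K)⁰ K) := by
  have h := mapIdeal_mapIdeal (algebraMap (reflexField Φ) L) ((σ : L →ₐ[ℚ] L) : L →+* L)
    (typeNorm (reflexField Φ) Φ (a : FractionalIdeal (𝓞 K)⁰ K))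
  rw [mapIdeal_typeNorm Φ (exists_algebraMap_eq_prod Φ) a] at h
  refine h.symm.trans ?_
  rw [typeNormL_apply, map_prod]
  refine Finset.prod_bij' (fun φ _ ↦ (σ : L →ₐ[ℚ] L).comp φ)
    (fun χ _ ↦ ((σ⁻¹ : L ≃ₐ[ℚ] L) : L →ₐ[ℚ] L).comp χ) ?_ ?_ ?_ ?_ ?_
  · intro φ hφ
    rw [Finset.mem_filter]
    refine ⟨Finset.mem_univ _, ?_⟩
    rw [show ((σ⁻¹ : L ≃ₐ[ℚ] L) : L →ₐ[ℚ] L).comp ((σ : L →ₐ[ℚ] L).comp φ) = φ from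
      AlgHom.ext fun x ↦ σ.symm_apply_apply (φ x)]
    simpa using hφ
  · intro χ hχ
    simpa using hχ
  · intro φ _
    ext z
    exact σ.symm_apply_apply (φ z)
  · intro χ _
    ext z
    exact σ.apply_symm_apply (χ z)
  · intro φ _
    rw [mapIdeal_mapIdeal]
    rfl

open Classical in
/-- The reflex type parametrizes the CM types containing the inclusion `K → L`. -/
theorem prod_reflexType [IsCMField K] [IsGalois ℚ L] [IsNormalClosure ℚ K L]
    (hK : Module.finrank ℚ K = 6)
    (hG : Nonempty ((L ≃ₐ[ℚ] L) ≃* C2CubedC3) ∨ Nonempty ((L ≃ₐ[ℚ] L) ≃* C2CubedS3))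
    {Φ : Set (K →ₐ[ℚ] L)} (hΦ : IsCMType Φ) (a : (FractionalIdeal (𝓞 K)⁰ K)ˣ) :
    typeNormL (reflexType Φ) (typeNorm (reflexField Φ) Φ (a : FractionalIdeal (𝓞 K)⁰ K)) =
      ∏ S ∈ (Finset.univ : Finset (Finset (K →ₐ[ℚ] L))).filter (fun S ↦
          (∀ χ, χ.comp (conj K) ∈ S ↔ χ ∉ S) ∧ IsScalarTower.toAlgHom ℚ K L ∈ S),
        ∏ χ ∈ S, mapIdeal (χ : K →+* L) (a : FractionalIdeal (𝓞 K)⁰ K) := by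
  have hΦ' := isCMType_iff.1 hΦ
  rw [typeNormL_apply]
  have hrep : ∀ ψ ∈ (Set.toFinite (reflexType Φ)).toFinset, ∃ σ : L ≃ₐ[ℚ] L,
      ((σ⁻¹ : L ≃ₐ[ℚ] L) : L →ₐ[ℚ] L).comp (IsScalarTower.toAlgHom ℚ K L) ∈ Φ ∧
        reflexRestrict Φ σ = ψ :=
    fun ψ hψ ↦ mem_reflexType_iff.1 ((Set.Finite.mem_toFinset _).1 hψ)
  -- The bijection sends `ψ` to `σΦ` for a chosen lift `σ`; by `reflexRestrict_eq_iff` the choice is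
  -- immaterial.
  choose! s hs hsψ using hrep
  refine Finset.prod_bij (fun ψ _ ↦ Finset.univ.filter
    (fun χ ↦ (((s ψ)⁻¹ : L ≃ₐ[ℚ] L) : L →ₐ[ℚ] L).comp χ ∈ Φ)) ?_ ?_ ?_ ?_
  · intro ψ hψ
    simp only [Finset.mem_filter, Finset.mem_univ, true_and]
    exact ⟨fun χ ↦ hΦ' ((((s ψ)⁻¹ : L ≃ₐ[ℚ] L) : L →ₐ[ℚ] L).comp χ), hs ψ hψ⟩
  · intro ψ hψ ψ' hψ' h
    rw [← hsψ ψ hψ, ← hsψ ψ' hψ', reflexRestrict_eq_iff]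
    intro χ
    simpa using Finset.ext_iff.1 h χ
  · intro S hS
    simp only [Finset.mem_filter, Finset.mem_univ, true_and] at hS
    -- Surjectivity is where transitivity enters: `S = g⁻¹Φ`, so `S` comes from the restriction of
    -- `g⁻¹`.
    obtain ⟨g, hg⟩ := exists_comp_mem_iff hK hG (S := (S : Set (K →ₐ[ℚ] L)))
      (isCMType_iff.2 hS.1) hΦ
    have hmem : reflexRestrict Φ g⁻¹ ∈ (Set.toFinite (reflexType Φ)).toFinset := by
      refine (Set.Finite.mem_toFinset _).2 (mem_reflexType_iff.2 ⟨g⁻¹, ?_, rfl⟩)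
      rw [inv_inv]
      exact (hg _).1 hS.2
    refine ⟨_, hmem, ?_⟩
    ext χ
    have := reflexRestrict_eq_iff.1 (hsψ _ hmem) χ
    rw [inv_inv] at this
    simpa [this] using (hg χ).symm
  · intro ψ hψ
    rw [← mapIdeal_reflexRestrict_typeNorm, hsψ ψ hψ]

end CMTypes

/-! ### The double type norm and its consequence for class groups -/

open FractionalIdeal in
/-- The formula for the double type norm, as an equality of fractional ideals of `L`. -/
theorem doubleTypeNorm_eq {K L : Type*} [Field K] [NumberField K] [IsCMField K]
    [Field L] [NumberField L] [Algebra K L] [IsGalois ℚ L] [IsNormalClosure ℚ K L]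
    (hK : Module.finrank ℚ K = 6)
    (hG : Nonempty ((L ≃ₐ[ℚ] L) ≃* C2CubedC3) ∨ Nonempty ((L ≃ₐ[ℚ] L) ≃* C2CubedS3))
    {Φ : Set (K →ₐ[ℚ] L)} (hΦ : IsCMType Φ) (a : (FractionalIdeal (𝓞 K)⁰ K)ˣ) :
    typeNormL (reflexType Φ) (typeNorm (reflexField Φ) Φ (a : FractionalIdeal (𝓞 K)⁰ K)) =
      spanSingleton (𝓞 L)⁰ ((absNorm (a : FractionalIdeal (𝓞 K)⁰ K) : ℚ) : L) ^ 2 *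
        mapIdeal (algebraMap K L)
          (a * (mapIdeal (conj K : K →+* K) (a : FractionalIdeal (𝓞 K)⁰ K))⁻¹) ^ 2 := by
  classical
  have h := prod_transversals (card_algHom_eq_finrank.trans hK)
    (c := fun χ : K →ₐ[ℚ] L ↦ χ.comp (conj K)) comp_conj_comp_conj comp_conj_ne
    (IsScalarTower.toAlgHom ℚ K L)
    (fun χ ↦ mapIdeal (χ : K →+* L) (a : FractionalIdeal (𝓞 K)⁰ K))
  have hconj : mapIdeal ((IsScalarTower.toAlgHom ℚ K L).comp (conj K) : K →+* L)
      (a : FractionalIdeal (𝓞 K)⁰ K) =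
      mapIdeal (algebraMap K L) (mapIdeal (conj K : K →+* K) (a : FractionalIdeal (𝓞 K)⁰ K)) := by
    rw [mapIdeal_mapIdeal]
    rfl
  have hne : mapIdeal (algebraMap K L)
      (mapIdeal (conj K : K →+* K) (a : FractionalIdeal (𝓞 K)⁰ K)) ≠ 0 :=
    (_root_.map_ne_zero _).2 ((_root_.map_ne_zero _).2 a.ne_zero)
  rw [← spanSingleton_absNorm, hconj] at h
  rw [prod_reflexType hK hG hΦ, map_mul, map_inv₀, mul_pow, inv_pow, ← mul_assoc,
    eq_mul_inv_iff_mul_eq₀ (pow_ne_zero 2 hne)]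
  exact h

end SexticCM

/-- For a sextic CM field `K` with Galois closure `L` and Galois group `C₂³ ⋊ C₃` or `C₂³ ⋊ S₃`,
and a CM type `Φ` of `K`: the formula for the double type norm, as an equality of fractional
ideals of `L`, and the resulting statement about the image of `N_{Φ^r} : Cl(K^r) → Cl(K)`. -/
theorem mainTheorem4 {K L : Type*} [Field K] [NumberField K] [IsCMField K]
    [Field L] [NumberField L] [Algebra K L] [IsGalois ℚ L] [IsNormalClosure ℚ K L]
    (hK : Module.finrank ℚ K = 6)
    (hG : Nonempty ((L ≃ₐ[ℚ] L) ≃* C2CubedC3) ∨ Nonempty ((L ≃ₐ[ℚ] L) ≃* C2CubedS3))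
    (Φ : Set (K →ₐ[ℚ] L)) (hΦ : IsCMType Φ) :
    (∀ a : (FractionalIdeal (𝓞 K)⁰ K)ˣ,
      typeNormL (reflexType Φ) (typeNorm (reflexField Φ) Φ (a : FractionalIdeal (𝓞 K)⁰ K)) =
        FractionalIdeal.spanSingleton (𝓞 L)⁰
            ((FractionalIdeal.absNorm (a : FractionalIdeal (𝓞 K)⁰ K) : ℚ) : L) ^ 2 *
          mapIdeal (algebraMap K L)
            (a * (mapIdeal (conj K : K →+* K) (a : FractionalIdeal (𝓞 K)⁰ K))⁻¹) ^ 2) ∧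
    (∀ (b : (FractionalIdeal (𝓞 K)⁰ K)ˣ) (β : (maximalRealSubfield K)ˣ),
      (b : FractionalIdeal (𝓞 K)⁰ K) *
          mapIdeal (conj K : K →+* K) (b : FractionalIdeal (𝓞 K)⁰ K) =
        FractionalIdeal.spanSingleton (𝓞 K)⁰ ((β : maximalRealSubfield K) : K) →
      ClassGroup.mk K (b ^ 4) ∈ Set.range (reflexTypeNorm Φ)) := by
  refine ⟨fun a ↦ doubleTypeNorm_eq hK hG hΦ a, fun b β hβ ↦ ?_⟩
  refine ⟨ClassGroup.mk _ (typeNormUnits (reflexField Φ) Φ b), ?_⟩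
  rw [reflexTypeNorm_mk]
  set N : ℚ := FractionalIdeal.absNorm (b : FractionalIdeal (𝓞 K)⁰ K) with hN
  have hN0 : (N : K) ≠ 0 := by
    rw [Rat.cast_ne_zero, hN, Ne, FractionalIdeal.absNorm_eq_zero_iff]
    exact b.ne_zero
  have hβ0 : ((β : maximalRealSubfield K) : K) ≠ 0 := by
    rw [Ne, ZeroMemClass.coe_eq_zero]
    exact β.ne_zero
  -- The hypothesis gives `β⁻¹𝔟` for the inverse of the conjugate of `𝔟`, so the double type norm is
  -- `N(𝔟)² β⁻² 𝔟⁴`, and `x = N(𝔟)² β⁻²`.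
  set x : Kˣ := Units.mk0 _ hN0 ^ 2 * (Units.mk0 _ hβ0)⁻¹ ^ 2 with hx
  have hprod : typeNormUnits K (reflexType Φ) (typeNormUnits (reflexField Φ) Φ b) =
      toPrincipalIdeal (𝓞 K) K x * b ^ 4 := by
    ext1
    have hconj : (mapIdeal (conj K : K →+* K) (b : FractionalIdeal (𝓞 K)⁰ K))⁻¹ =
        (FractionalIdeal.spanSingleton (𝓞 K)⁰ ((β : maximalRealSubfield K) : K))⁻¹ * b := by
      rw [← hβ, mul_inv, mul_right_comm, inv_mul_cancel₀ b.ne_zero, one_mul]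
    -- Contraction undoes extension, so the formula over `L` descends to `K`.
    rw [← contract_mapIdeal (L := L) (toPrincipalIdeal (𝓞 K) K x * b ^ 4)]
    simp only [typeNormUnits, Units.val_mk0]
    rw [typeNorm, doubleTypeNorm_eq hK hG hΦ b, hconj, ← map_pow, ← map_ratCast (algebraMap K L),
      ← mapIdeal_spanSingleton, ← map_pow, ← map_mul]
    congr 2
    rw [Units.val_mul, coe_toPrincipalIdeal, Units.val_pow_eq_pow_val, hx, Units.val_mul,
      Units.val_pow_eq_pow_val, Units.val_pow_eq_pow_val, Units.val_inv_eq_inv_val, Units.val_mk0,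
      Units.val_mk0, ← FractionalIdeal.spanSingleton_mul_spanSingleton,
      ← FractionalIdeal.spanSingleton_pow, ← FractionalIdeal.spanSingleton_pow,
      ← FractionalIdeal.spanSingleton_inv]
    ring
  have hprin : ClassGroup.mk K (toPrincipalIdeal (𝓞 K) K x) = 1 := by
    rw [ClassGroup.mk_eq_one_iff, coe_toPrincipalIdeal]
    exact (FractionalIdeal.isPrincipal_iff _).2 ⟨_, rfl⟩
  rw [hprod, map_mul, hprin, one_mul]
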